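/- **Conventions.** Everything is real, smooth ($C^\infty$) and local. Let $n\ge 1$. A *ruled hypersurface* of codimension two in $\mathbb P^{n+3}$ is given by its line generators: a smooth $n$-parameter family of lines $l(u)=\mathbb P(\Lambda(u))$, with $\Lambda(u)\subset\mathbb R^{n+4}$ a plane and $u$ in an open set $U\subset\mathbb R^n$, which sweeps out an $(n+1)$-dimensional hypersurface $\Sigma$, in the sense that each generator contains a point at which the sweeping map $(u,[a:b])\mapsto[aX(u)+bY(u)]$ is an immersion ($X,Y$ a local smooth frame of $\Lambda$). A *Hamiltonian system of hydrodynamic type* is $u^i_t=\varepsilon^i\frac{d}{dx}\big(\frac{\partial h}{\partial u^i}\big)$, $i=1,\dots,n$, with $\varepsilon^i=\pm1$ and $h$ a smooth function on an open set $V\subset\mathbb R^n$. Writing $h_i=\partial h/\partial u^i$ and $|v|^2=\sum_i\varepsilon^i v_i^2$, it has the conservation laws $u^i\,dx+\varepsilon^ih_i\,dt$, $\ \frac12|u|^2dx+(\sum_i h_iu^i-h)\,dt$, $\ h\,dx+\frac12|\nabla h|^2dt$, and to it one assigns the lines spanned by $$p(u)=[1:u^1:\dots:u^n:\tfrac12|u|^2:h:0],\qquad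 r(u)=[0:\varepsilon^1h_1:\dots:\varepsilon^nh_n:\textstyle\sum_i h_iu^i-h:\tfrac12|\nabla h|^2:1].$$ A ruled hypersurface *corresponds to* the Hamiltonian system if, after a diffeomorphism of the parameter domain onto $V$ and a projective transformation of $\mathbb P^{n+3}$, its generators are the lines $pr$. For a smooth quadric $Q=\{(X,X)=0\}\subset\mathbb P^{n+3}$, with $(\cdot,\cdot)$ a nondegenerate symmetric bilinear form on $\mathbb R^{n+4}$, let $F_{1,n+2}$ be the $(2n+1)$-dimensional Fano variety of lines on $Q$. Its tangent space at $l=\mathbb P(\Lambda)$ consists of the $\overline\varphi\in\mathrm{Hom}(\Lambda,\mathbb R^{n+4}/\Lambda)$ with $\overline\varphi(X)\in T_{[X]}Q/\Lambda$ for $X\in\Lambda$, where $T_{[X]}Q=\{Z:(X,Z)=0\}$. The contact structure is the distribution $\tau$ of those $\overline\varphi$ with $(X,\varphi(Y))=0$ for all $X,Y\in\Lambda$, where $\varphi$ is any lift of $\overline\varphi$ to $\mathrm{Hom}(\Lambda,\mathbb R^{n+4})$. A *Legendre submanifold* is an immersed $n$-dimensional submanifold of $F_{1,n+2}$ that is tangent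 to $\tau$. **Theorem.** Let $\Sigma$ be a ruled hypersurface of codimension two in $\mathbb P^{n+3}$. 1. Near each of its line generators, $\Sigma$ corresponds to a Hamiltonian system of hydrodynamic type if and only if its line generators form a Legendre submanifold of the Fano variety $F_{1,n+2}$ of some smooth quadric in $\mathbb P^{n+3}$. (That is, for every $u_0\in U$: the generators with parameters in some open neighbourhood $W\subset U$ of $u_0$ have the first property iff the generators with parameters in some open neighbourhood $W'\subset U$ of $u_0$ have the second one.) 2. If the whole of $\Sigma$ corresponds to one Hamiltonian system, then all its line generators together form a Legendre submanifold of the Fano variety of a single smooth quadric. 3. Whenever $\Sigma$, or the part of it with parameters in a subset $W\subset U$, corresponds to the Hamiltonian system given by $\varepsilon,h,V$, the $n+4$ one-forms consisting of $dx$, $dt$ and the $n+2$ conservation laws above are linearly independent over $\mathbb R$ on $V\times\mathbb R^2$ if and only if $\Sigma$ (respectively that part) does not lie in a hyperplane. -/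

import Mathlib

open scoped ContDiff Topology

noncomputable section

namespace HydroLegendre

/-- The space `ℝ^n` of field variables (parameters). -/
abbrev Par (n : ℕ) : Type := Fin n → ℝ

/-- The vector space `ℝ^(n+4)` whose projectivization is the projective space `P^(n+3)`.
Lines in `P^(n+3)` are the submodules of rank two of this space. -/
abbrev Amb (n : ℕ) : Type := Fin (n + 4) → ℝ

/-- The vector with homogeneous coordinates `[a : w^1 : ... : w^n : b : c : d]`. -/
def homVec {n : ℕ} (a : ℝ) (w : Par n) (b c d : ℝ) : Amb n :=
  Fin.cons a (Fin.append w ![b, c, d])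

/-! ### Ruled hypersurfaces of codimension two -/

/-- `X, Y` is a smooth frame over the set `W` for the family of lines `L`. -/
def IsSmoothFrame {n : ℕ} (W : Set (Par n)) (L : Par n → Submodule ℝ (Amb n))
    (X Y : Par n → Amb n) : Prop :=
  ContDiffOn ℝ ∞ X W ∧ ContDiffOn ℝ ∞ Y W ∧
    ∀ w ∈ W, LinearIndependent ℝ ![X w, Y w] ∧ L w = Submodule.span ℝ {X w, Y w}

/-- The lines with frame `X, Y` sweep out an `(n+1)`-dimensional hypersurface of `P^(n+3)` near
some point `[a X(u) + b Y(u)]` of the line with parameter `u`: the map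
`(w, a, b) ↦ a X(w) + b Y(w)` onto the `(n+2)`-dimensional affine cone is an immersion there. -/
def SweepsOut {n : ℕ} (X Y : Par n → Amb n) (u : Par n) : Prop :=
  ∃ a b : ℝ, Function.Injective
    (fderiv ℝ (fun q : Par n × ℝ × ℝ => q.2.1 • X q.1 + q.2.2 • Y q.1) (u, a, b))

/-- A ruled hypersurface of codimension two in `P^(n+3)`, given by its line generators: a smooth
`n`-parameter family of lines `L u`, `u ∈ U`, sweeping out an `(n+1)`-dimensional hypersurface,
which is immersed at the general point of each generator. -/
def IsRuledHypersurface {n : ℕ} (U : Set (Par n)) (L : Par n → Submodule ℝ (Amb n)) : Prop :=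
  IsOpen U ∧ ∀ u ∈ U, ∃ W : Set (Par n), IsOpen W ∧ u ∈ W ∧ W ⊆ U ∧
    ∃ X Y : Par n → Amb n, IsSmoothFrame W L X Y ∧ SweepsOut X Y u

/-- The hypersurface swept out by the lines `L u`, `u ∈ U`, does not lie in any hyperplane. -/
def IsNondegenerate {n : ℕ} (U : Set (Par n)) (L : Par n → Submodule ℝ (Amb n)) : Prop :=
  ∀ H : Submodule ℝ (Amb n), (∀ u ∈ U, L u ≤ H) → H = ⊤

/-! ### Systems of conservation laws and their ruled hypersurfaces -/

/-- The densities and fluxes of the system `u^i_t = (f^i(u))_x` together with two additional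
conservation laws `B dx + A dt` and `N dx + M dt`. -/
structure LawSystem (n : ℕ) where
  f : Par n → Par n
  B : Par n → ℝ
  A : Par n → ℝ
  N : Par n → ℝ
  M : Par n → ℝ

/-- The point `p = [1 : u^1 : ... : u^n : B : N : 0]`. -/
def LawSystem.p {n : ℕ} (S : LawSystem n) (u : Par n) : Amb n :=
  homVec 1 u (S.B u) (S.N u) 0

/-- The point `r = [0 : f^1 : ... : f^n : A : M : 1]`. -/
def LawSystem.r {n : ℕ} (S : LawSystem n) (u : Par n) : Amb n :=
  homVec 0 (S.f u) (S.A u) (S.M u) 1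

/-- The line `Y^i = u^i Y^0 + f^i Y^(n+3)`, `Y^(n+1) = B Y^0 + A Y^(n+3)`,
`Y^(n+2) = N Y^0 + M Y^(n+3)`. -/
def LawSystem.line {n : ℕ} (S : LawSystem n) (u : Par n) : Submodule ℝ (Amb n) :=
  Submodule.span ℝ {S.p u, S.r u}

/-- The `n + 4` one-forms `dx`, `u^i dx + f^i dt`, `B dx + A dt`, `N dx + M dt`, `dt` on
`V × ℝ²` are linearly independent over `ℝ`; a form is given by its coefficients at `dx`, `dt`. -/
def LawSystem.Independent {n : ℕ} (S : LawSystem n) (V : Set (Par n)) : Prop :=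
  LinearIndependent ℝ
    (fun (j : Fin (n + 4)) => (fun u : V => (S.p u j, S.r u j) : V → ℝ × ℝ))

/-- The ruled hypersurface with generators `L w`, `w ∈ W`, corresponds to the system `S` with field
variables in `V`: up to a projective transformation `g` of `P^(n+3)` and a smooth change `φ` of
parameters, the generators are the lines of the system. -/
def CorrespondsTo {n : ℕ} (W : Set (Par n)) (L : Par n → Submodule ℝ (Amb n))
    (S : LawSystem n) (V : Set (Par n)) : Prop :=
  ∃ (g : Amb n ≃ₗ[ℝ] Amb n) (φ : OpenPartialHomeomorph (Par n) (Par n)),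
    φ.source = W ∧ φ.target = V ∧ ContDiffOn ℝ ∞ φ W ∧ ContDiffOn ℝ ∞ φ.symm V ∧
      ∀ w ∈ W, L w = (S.line (φ w)).map (g : Amb n →ₗ[ℝ] Amb n)

/-- The partial derivative `h_i = ∂h/∂u^i`. -/
def partialDeriv {n : ℕ} (h : Par n → ℝ) (i : Fin n) (u : Par n) : ℝ :=
  fderiv ℝ h u (Pi.single i 1)

/-- The Hamiltonian system `u^i_t = ε^i (h_i)_x` with its two additional conservation laws
`|u|²/2 dx + (h_i u^i - h) dt` and `h dx + |∇h|²/2 dt`, where `|v|² = ∑ ε^i (v_i)²`. -/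
def hamiltonianSystem {n : ℕ} (ε : Fin n → ℝ) (h : Par n → ℝ) : LawSystem n where
  f u := fun i => ε i * partialDeriv h i u
  B u := (∑ i, ε i * u i ^ 2) / 2
  A u := ∑ i, partialDeriv h i u * u i - h u
  N u := h u
  M u := (∑ i, ε i * partialDeriv h i u ^ 2) / 2

/-- `ε, h, V` are the data of a Hamiltonian system: signs `ε^i = ±1` and a smooth Hamiltonian
density `h` on an open set `V` of field variables. -/
def IsHamiltonianData {n : ℕ} (ε : Fin n → ℝ) (h : Par n → ℝ) (V : Set (Par n)) : Prop :=
  (∀ i, ε i = 1 ∨ ε i = -1) ∧ IsOpen V ∧ ContDiffOn ℝ ∞ h V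

/-- The ruled hypersurface with generators `L w`, `w ∈ W`, corresponds to a Hamiltonian system. -/
def CorrespondsToHamiltonian {n : ℕ} (W : Set (Par n)) (L : Par n → Submodule ℝ (Amb n)) : Prop :=
  ∃ (ε : Fin n → ℝ) (h : Par n → ℝ) (V : Set (Par n)),
    IsHamiltonianData ε h V ∧ CorrespondsTo W L (hamiltonianSystem ε h) V

/-! ### The Fano variety of lines on a quadric and its contact distribution -/

/-- The quadric `β(X, X) = 0` in `P^(n+3)` is smooth. -/
def IsSmoothQuadric {n : ℕ} (β : LinearMap.BilinForm ℝ (Amb n)) : Prop :=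
  β.IsSymm ∧ β.Nondegenerate

/-- The Fano variety of lines on the quadric `β(X, X) = 0`. -/
def fano {n : ℕ} (β : LinearMap.BilinForm ℝ (Amb n)) : Set (Submodule ℝ (Amb n)) :=
  {Λ | Module.finrank ℝ Λ = 2 ∧ ∀ X ∈ Λ, β X X = 0}

/-- The tangent space of the Fano variety at `Λ`: all `φ ∈ Hom(Λ, ℝ^(n+4)/Λ)` with
`φ(X) ∈ T_[X] Q / Λ`, where `T_[X] Q` is the hyperplane `β(X, ·) = 0`. -/
def fanoTangent {n : ℕ} (β : LinearMap.BilinForm ℝ (Amb n)) (Λ : Submodule ℝ (Amb n)) :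
    Submodule ℝ (Λ →ₗ[ℝ] Amb n ⧸ Λ) where
  carrier := {φ | ∀ X : Λ, φ X ∈ (LinearMap.ker (β (X : Amb n))).map Λ.mkQ}
  zero_mem' := fun _ => Submodule.zero_mem _
  add_mem' := fun h₁ h₂ X => Submodule.add_mem _ (h₁ X) (h₂ X)
  smul_mem' := fun c _ h₁ X => Submodule.smul_mem _ c (h₁ X)

/-- The contact distribution `τ`: all tangent vectors `φ` of the Fano variety at `Λ` such that
`(X, φ(Y)) = 0` for all `X, Y ∈ Λ`. -/
def contactDistribution {n : ℕ} (β : LinearMap.BilinForm ℝ (Amb n)) (Λ : Submodule ℝ (Amb n)) :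
    Submodule ℝ (Λ →ₗ[ℝ] Amb n ⧸ Λ) where
  carrier := {φ | φ ∈ fanoTangent β Λ ∧
    ∀ X Y : Λ, φ Y ∈ (LinearMap.ker (β (X : Amb n))).map Λ.mkQ}
  zero_mem' := ⟨Submodule.zero_mem _, fun _ _ => Submodule.zero_mem _⟩
  add_mem' := fun h₁ h₂ => ⟨Submodule.add_mem _ h₁.1 h₂.1,
    fun X Y => Submodule.add_mem _ (h₁.2 X Y) (h₂.2 X Y)⟩
  smul_mem' := fun c _ h₁ => ⟨Submodule.smul_mem _ c h₁.1,
    fun X Y => Submodule.smul_mem _ c (h₁.2 X Y)⟩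

/-- `φ ∈ Hom(L u, ℝ^(n+4)/L u)` is the derivative of the family of lines `L` at `u` in the
direction `v`, as a tangent vector of the Grassmannian: it sends the value `s(u)` of any
section `s` of the family to the class of the directional derivative of `s`. -/
def IsVelocity {n : ℕ} (L : Par n → Submodule ℝ (Amb n)) (u v : Par n)
    (φ : L u →ₗ[ℝ] Amb n ⧸ L u) : Prop :=
  ∀ s : Par n → Amb n, DifferentiableAt ℝ s u → ∀ hs : ∀ᶠ w in 𝓝 u, s w ∈ L w,
    φ ⟨s u, hs.self_of_nhds⟩ = (L u).mkQ (fderiv ℝ s u v)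

/-- The lines `L u`, `u ∈ U`, form a Legendre submanifold of the `(2n+1)`-dimensional Fano variety
of the quadric `β(X, X) = 0`: an immersed `n`-dimensional submanifold of the Fano variety that is
tangent to the contact distribution. -/
def IsLegendre {n : ℕ} (U : Set (Par n)) (L : Par n → Submodule ℝ (Amb n))
    (β : LinearMap.BilinForm ℝ (Amb n)) : Prop :=
  ∀ u ∈ U, L u ∈ fano β ∧ ∀ v : Par n, ∃ φ : L u →ₗ[ℝ] Amb n ⧸ L u,
    IsVelocity L u v φ ∧ φ ∈ contactDistribution β (L u) ∧ (v ≠ 0 → φ ≠ 0)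

end HydroLegendre

end

open scoped ContDiff Topology

noncomputable section

namespace HydroLegendre

/-! The link is one fixed bilinear form, `normalForm ε`, which depends neither on `h` nor on `u`. On
the lines `pr` of a Hamiltonian system its isotropy conditions $(p,p)=(p,r)=(r,r)=0$ say precisely
that the densities and fluxes of the two additional laws are $\frac12|u|^2$, $\sum h_iu^i-h$ and
$\frac12|\nabla h|^2$, and the contact condition $(r,dp)=0$ says $dh=\sum h_i\,du^i$. The remaining
contact pairings follow by differentiating isotropy, and the coordinates $u^i$ of `p` make the
family immersed. No shrinking occurs, so one quadric serves the whole domain.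

Conversely, let the generators be Legendre for a smooth quadric. The sweeping hypothesis provides a
point of the generator at $u_0$ whose displacement is transversal to the line
(`exists_transversal_frame`). Completing the generator to two hyperbolic planes and diagonalizing
the form on their orthogonal complement gives coordinates in which the quadric is `normalForm ε`,
that point is $[1:0:\dots:0]$ and the line also contains $[0:\dots:0:1]$
(`exists_equiv_normalForm`). After normalizing the frame, the middle coordinates of the first vector
are local parameters: a direction killing them kills the whole derivative, by isotropy and contact
at $u_0$. With `h` its second last homogeneous coordinate, contact identifies the middle coordinates
of the second vector as $\varepsilon^ih_i$, and isotropy determines everything else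
(`correspondsToHamiltonian_of_normalForm`).

The independence statement is duality: a constant-coefficient relation among the forms is a covector
annihilating all `p(u)` and `r(u)`. -/

variable {n : ℕ}

/-! ### Homogeneous coordinates -/

/-- The coordinate `a` of `[a : w : b : c : d]`. -/
def coordA : Amb n →L[ℝ] ℝ := ContinuousLinearMap.proj 0

/-- The coordinates `w` of `[a : w : b : c : d]`. -/
def coordW : Amb n →L[ℝ] Par n :=
  ContinuousLinearMap.pi fun i => ContinuousLinearMap.proj (Fin.succ (Fin.castAdd 3 i))

/-- The coordinate `b` of `[a : w : b : c : d]`. -/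
def coordB : Amb n →L[ℝ] ℝ := ContinuousLinearMap.proj (Fin.succ (Fin.natAdd n (0 : Fin 3)))

/-- The coordinate `c` of `[a : w : b : c : d]`. -/
def coordC : Amb n →L[ℝ] ℝ := ContinuousLinearMap.proj (Fin.succ (Fin.natAdd n (1 : Fin 3)))

/-- The coordinate `d` of `[a : w : b : c : d]`. -/
def coordD : Amb n →L[ℝ] ℝ := ContinuousLinearMap.proj (Fin.succ (Fin.natAdd n (2 : Fin 3)))

section homVec

variable (a : ℝ) (w : Par n) (b c d : ℝ)

@[simp] lemma coordA_homVec : coordA (homVec a w b c d) = a := rfl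

@[simp] lemma coordW_homVec : coordW (homVec a w b c d) = w := by
  ext i
  change Fin.append w ![b, c, d] (Fin.castAdd 3 i) = _
  simp

@[simp] lemma coordB_homVec : coordB (homVec a w b c d) = b := by
  change Fin.append w ![b, c, d] (Fin.natAdd n 0) = _
  rw [Fin.append_right]; rfl

@[simp] lemma coordC_homVec : coordC (homVec a w b c d) = c := by
  change Fin.append w ![b, c, d] (Fin.natAdd n 1) = _
  rw [Fin.append_right]; rfl

@[simp] lemma coordD_homVec : coordD (homVec a w b c d) = d := by
  change Fin.append w ![b, c, d] (Fin.natAdd n 2) = _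
  rw [Fin.append_right]; rfl

end homVec

lemma amb_ext {x y : Amb n} (hA : coordA x = coordA y) (hW : coordW x = coordW y)
    (hB : coordB x = coordB y) (hC : coordC x = coordC y) (hD : coordD x = coordD y) :
    x = y := by
  funext j
  refine Fin.cases hA (fun j => ?_) j
  refine Fin.addCases (m := n) (n := 3) (fun i => congrFun hW i) (fun k => ?_) j
  fin_cases k
  exacts [hB, hC, hD]

lemma differentiableAt_homVec {E : Type*} [NormedAddCommGroup E] [NormedSpace ℝ E] {x : E}
    {a : E → ℝ} {w : E → Par n} {b c d : E → ℝ}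
    (ha : DifferentiableAt ℝ a x) (hw : DifferentiableAt ℝ w x) (hb : DifferentiableAt ℝ b x)
    (hc : DifferentiableAt ℝ c x) (hd : DifferentiableAt ℝ d x) :
    DifferentiableAt ℝ (fun y => homVec (a y) (w y) (b y) (c y) (d y)) x := by
  rw [differentiableAt_pi]
  intro j
  refine Fin.cases ha (fun j => ?_) j
  refine Fin.addCases (m := n) (n := 3) (fun i => ?_) (fun k => ?_) j
  · simpa [homVec] using differentiableAt_pi.1 hw i
  · fin_cases k
    exacts [by simpa [homVec] using hb, by simpa [homVec] using hc, by simpa [homVec] using hd]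

lemma apply_fderiv {E F G : Type*} [NormedAddCommGroup E] [NormedSpace ℝ E]
    [NormedAddCommGroup F] [NormedSpace ℝ F] [NormedAddCommGroup G] [NormedSpace ℝ G]
    {f : E → F} {x : E} (ℓ : F →L[ℝ] G) (hf : DifferentiableAt ℝ f x) (v : E) :
    ℓ (fderiv ℝ f x v) = fderiv ℝ (fun y => ℓ (f y)) x v := by
  rw [show (fun y => ℓ (f y)) = ℓ ∘ f from rfl, fderiv_comp x ℓ.differentiableAt hf]
  simp

lemma apply_fderiv_eq_zero {E F G : Type*} [NormedAddCommGroup E] [NormedSpace ℝ E]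
    [NormedAddCommGroup F] [NormedSpace ℝ F] [NormedAddCommGroup G] [NormedSpace ℝ G]
    {f : E → F} {x : E} (ℓ : F →L[ℝ] G) (hf : DifferentiableAt ℝ f x) {c : G}
    (hc : ∀ᶠ y in 𝓝 x, ℓ (f y) = c) (v : E) : ℓ (fderiv ℝ f x v) = 0 := by
  rw [apply_fderiv ℓ hf, Filter.EventuallyEq.fderiv_eq (f := fun _ => c) hc]
  simp

lemma fderiv_eq_sum_partialDeriv (h : Par n → ℝ) (u v : Par n) :
    fderiv ℝ h u v = ∑ i, v i * partialDeriv h i u := by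
  conv_lhs => rw [pi_eq_sum_univ' v]
  rw [map_sum]
  refine Finset.sum_congr rfl fun i _ => ?_
  rw [map_smul, smul_eq_mul, partialDeriv]

lemma fderiv_bilin {E : Type*} [NormedAddCommGroup E] [NormedSpace ℝ E]
    (β : LinearMap.BilinForm ℝ (Amb n)) {X Y : E → Amb n} {x : E}
    (hX : DifferentiableAt ℝ X x) (hY : DifferentiableAt ℝ Y x) (v : E) :
    fderiv ℝ (fun w => β (X w) (Y w)) x v =
      β (X x) (fderiv ℝ Y x v) + β (fderiv ℝ X x v) (Y x) := by
  have h := (LinearMap.toContinuousBilinearMap β).hasFDerivAt_of_bilinear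
    hX.hasFDerivAt hY.hasFDerivAt
  have h2 := h.fderiv
  change fderiv ℝ (fun w => β (X w) (Y w)) x = _ at h2
  rw [h2]
  simp

lemma bilin_fderiv_eq_zero {E : Type*} [NormedAddCommGroup E] [NormedSpace ℝ E]
    (β : LinearMap.BilinForm ℝ (Amb n)) {X Y : E → Amb n} {x : E}
    (hX : DifferentiableAt ℝ X x) (hY : DifferentiableAt ℝ Y x)
    (h : ∀ᶠ w in 𝓝 x, β (X w) (Y w) = 0) (v : E) :
    β (X x) (fderiv ℝ Y x v) + β (fderiv ℝ X x v) (Y x) = 0 := by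
  rw [← fderiv_bilin β hX hY, Filter.EventuallyEq.fderiv_eq (f := fun _ => (0 : ℝ)) h]
  simp

/-! ### The normal form of the quadric -/

/-- The form `∑ ε^i x^i y^i - (x^0 y^(n+1) + x^(n+1) y^0) - (x^(n+2) y^(n+3) + x^(n+3) y^(n+2))`. -/
def normalForm (ε : Fin n → ℝ) : LinearMap.BilinForm ℝ (Amb n) :=
  LinearMap.mk₂ ℝ (fun x y => ∑ i, ε i * (coordW x i * coordW y i)
      - (coordA x * coordB y + coordB x * coordA y) - (coordC x * coordD y + coordD x * coordC y))
    (fun x x' y => by simp only [map_add, Pi.add_apply, add_mul, mul_add, Finset.sum_add_distrib]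
                      ring)
    (fun c x y => by
      simp only [map_smul, Pi.smul_apply, smul_eq_mul, mul_sub, mul_add, Finset.mul_sum]
      simp only [mul_assoc, mul_left_comm c])
    (fun x y y' => by simp only [map_add, Pi.add_apply, mul_add, Finset.sum_add_distrib]
                      ring)
    (fun c x y => by
      simp only [map_smul, Pi.smul_apply, smul_eq_mul, mul_sub, mul_add, Finset.mul_sum]
      simp only [mul_left_comm c])

lemma normalForm_apply (ε : Fin n → ℝ) (x y : Amb n) :
    normalForm ε x y = ∑ i, ε i * (coordW x i * coordW y i)
      - (coordA x * coordB y + coordB x * coordA y)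
      - (coordC x * coordD y + coordD x * coordC y) := rfl

lemma normalForm_comm (ε : Fin n → ℝ) (x y : Amb n) :
    normalForm ε x y = normalForm ε y x := by
  simp only [normalForm_apply, mul_comm (coordW x _)]
  ring

lemma eq_zero_of_normalForm_eq_zero {ε : Fin n → ℝ} (hε : ∀ i, ε i = 1 ∨ ε i = -1) {x : Amb n}
    (h : ∀ y, normalForm ε x y = 0) : x = 0 := by
  -- The form pairs the `A` slot with `B` and `C` with `D`, so each coordinate is read off by the
  -- basis vector of its partner slot.
  have hA := h (homVec 0 0 1 0 0)
  have hB := h (homVec 1 0 0 0 0)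
  have hC := h (homVec 0 0 0 0 1)
  have hD := h (homVec 0 0 0 1 0)
  simp [normalForm_apply] at hA hB hC hD
  refine amb_ext ?_ ?_ ?_ ?_ ?_ <;> simp [*]
  ext i
  have hW := h (homVec 0 (Pi.single i 1) 0 0 0)
  simp [normalForm_apply, Pi.single_apply] at hW
  rcases hε i with h' | h' <;> simpa [h'] using hW

lemma isSmoothQuadric_of_normalForm {ε : Fin n → ℝ} (hε : ∀ i, ε i = 1 ∨ ε i = -1)
    {β : LinearMap.BilinForm ℝ (Amb n)} (g : Amb n ≃ₗ[ℝ] Amb n)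
    (hβ : ∀ x y, β (g x) (g y) = normalForm ε x y) : IsSmoothQuadric β := by
  have hs : β.IsSymm := ⟨fun x y => by
    have := hβ (g.symm x) (g.symm y)
    have h2 := hβ (g.symm y) (g.symm x)
    simp only [LinearEquiv.apply_symm_apply] at this h2
    simp [this, h2, normalForm_comm ε (g.symm y)]⟩
  refine ⟨hs, ?_, ?_⟩
  · intro x hx
    have : g.symm x = 0 := eq_zero_of_normalForm_eq_zero hε fun y => by
      simpa [← hβ] using hx (g y)
    simpa using this
  · intro x hx
    have : g.symm x = 0 := eq_zero_of_normalForm_eq_zero hε fun y => by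
      rw [normalForm_comm]
      simpa [← hβ] using hx (g y)
    simpa using this

/-! ### Velocities of families of lines -/

/-- The vectors `X, Y` are dual to the functionals `a, c`. -/
def IsDualPair (a c : Amb n →L[ℝ] ℝ) (X Y : Amb n) : Prop :=
  a X = 1 ∧ a Y = 0 ∧ c X = 0 ∧ c Y = 1

lemma IsDualPair.eq_of_mem_span {a c : Amb n →L[ℝ] ℝ} {X Y Z : Amb n} (h : IsDualPair a c X Y)
    (hZ : Z ∈ Submodule.span ℝ {X, Y}) : Z = a Z • X + c Z • Y := by
  obtain ⟨s, t, rfl⟩ := Submodule.mem_span_pair.1 hZ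
  obtain ⟨h1, h2, h3, h4⟩ := h
  simp [h1, h2, h3, h4]

lemma IsDualPair.linearIndependent {a c : Amb n →L[ℝ] ℝ} {X Y : Amb n}
    (h : IsDualPair a c X Y) : LinearIndependent ℝ ![X, Y] := by
  obtain ⟨h1, h2, h3, h4⟩ := h
  rw [LinearIndependent.pair_iff]
  intro s t hst
  have hs := congrArg a hst
  have ht := congrArg c hst
  simp [h1, h2, h3, h4] at hs ht
  exact ⟨hs, ht⟩

lemma finrank_span_pair {X Y : Amb n} (h : LinearIndependent ℝ ![X, Y]) :
    Module.finrank ℝ (Submodule.span ℝ {X, Y}) = 2 := by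
  have := finrank_span_eq_card h
  rwa [Matrix.range_cons, Matrix.range_cons, Matrix.range_empty, Set.union_empty] at this

/-- Since `a` and `c` are constant functionals, any section is `a(s) X + c(s) Y`. In its derivative
the terms that differentiate the coefficients lie in the line and vanish in the quotient. -/
lemma isVelocity_of_dualPair {L : Par n → Submodule ℝ (Amb n)} {X Y : Par n → Amb n}
    {u : Par n} {a c : Amb n →L[ℝ] ℝ}
    (hX : DifferentiableAt ℝ X u) (hY : DifferentiableAt ℝ Y u)
    (hL : ∀ᶠ w in 𝓝 u, L w = Submodule.span ℝ {X w, Y w})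
    (hd : ∀ᶠ w in 𝓝 u, IsDualPair a c (X w) (Y w)) (v : Par n) :
    IsVelocity L u v (((a : Amb n →ₗ[ℝ] ℝ).smulRight ((L u).mkQ (fderiv ℝ X u v)) +
      (c : Amb n →ₗ[ℝ] ℝ).smulRight ((L u).mkQ (fderiv ℝ Y u v))).comp (L u).subtype) := by
  intro s hs hsL
  have hEq : s =ᶠ[𝓝 u] fun w => a (s w) • X w + c (s w) • Y w := by
    filter_upwards [hL, hd, hsL] with w h1 h2 h3
    exact h2.eq_of_mem_span (h1 ▸ h3)
  have hXu : X u ∈ L u := by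
    rw [hL.self_of_nhds]; exact Submodule.subset_span (by simp)
  have hYu : Y u ∈ L u := by
    rw [hL.self_of_nhds]; exact Submodule.subset_span (by simp)
  have hda : HasFDerivAt (fun w => a (s w)) (a.comp (fderiv ℝ s u)) u :=
    a.hasFDerivAt.comp u hs.hasFDerivAt
  have hdc : HasFDerivAt (fun w => c (s w)) (c.comp (fderiv ℝ s u)) u :=
    c.hasFDerivAt.comp u hs.hasFDerivAt
  rw [hEq.fderiv_eq, ((hda.fun_smul hX.hasFDerivAt).fun_add (hdc.fun_smul hY.hasFDerivAt)).fderiv]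
  have h1 : (L u).mkQ (X u) = 0 := by simpa using hXu
  have h2 : (L u).mkQ (Y u) = 0 := by simpa using hYu
  simp only [Submodule.mkQ_apply] at h1 h2
  simp [h1, h2]

/-- Of the four contact pairings only $(Y,dX)=0$ has to be assumed: differentiating $(X,X)=(Y,Y)=0$
gives $(X,dX)=(Y,dY)=0$, and differentiating $(X,Y)=0$ then gives $(X,dY)=0$. -/
lemma isLegendre_of_dualPair {U : Set (Par n)} {L : Par n → Submodule ℝ (Amb n)}
    {β : LinearMap.BilinForm ℝ (Amb n)} (hβ : β.IsSymm) {X Y : Par n → Amb n}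
    {a c : Amb n →L[ℝ] ℝ} (hU : IsOpen U)
    (hX : ∀ u ∈ U, DifferentiableAt ℝ X u) (hY : ∀ u ∈ U, DifferentiableAt ℝ Y u)
    (hL : ∀ u ∈ U, L u = Submodule.span ℝ {X u, Y u})
    (hd : ∀ u ∈ U, IsDualPair a c (X u) (Y u))
    (hXX : ∀ u ∈ U, β (X u) (X u) = 0) (hXY : ∀ u ∈ U, β (X u) (Y u) = 0)
    (hYY : ∀ u ∈ U, β (Y u) (Y u) = 0)
    (hYdX : ∀ u ∈ U, ∀ v, β (Y u) (fderiv ℝ X u v) = 0)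
    (himm : ∀ u ∈ U, ∀ v, fderiv ℝ X u v = 0 → v = 0) : IsLegendre U L β := by
  intro u hu
  have hUu : ∀ᶠ w in 𝓝 u, w ∈ U := hU.mem_nhds hu
  have hXu : X u ∈ L u := by
    rw [hL u hu]; exact Submodule.subset_span (by simp)
  have hYX : β (Y u) (X u) = 0 := by rw [← hβ.eq]; simpa using hXY u hu
  refine ⟨⟨?_, ?_⟩, fun v => ⟨_, isVelocity_of_dualPair (hX u hu) (hY u hu) (hUu.mono hL)
    (hUu.mono hd) v, ?_, ?_⟩⟩
  · rw [hL u hu]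
    exact finrank_span_pair (hd u hu).linearIndependent
  · intro Z hZ
    rw [hL u hu] at hZ
    obtain ⟨s, t, rfl⟩ := Submodule.mem_span_pair.1 hZ
    simp [hXX u hu, hXY u hu, hYY u hu, hYX]
  · have hXdX : β (X u) (fderiv ℝ X u v) = 0 := by
      have := bilin_fderiv_eq_zero β (hX u hu) (hX u hu) (hUu.mono hXX) v
      have h2 := hβ.eq (X u) (fderiv ℝ X u v)
      linarith
    have hYdY : β (Y u) (fderiv ℝ Y u v) = 0 := by
      have := bilin_fderiv_eq_zero β (hY u hu) (hY u hu) (hUu.mono hYY) v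
      have h2 := hβ.eq (Y u) (fderiv ℝ Y u v)
      linarith
    have hXdY : β (X u) (fderiv ℝ Y u v) = 0 := by
      have := bilin_fderiv_eq_zero β (hX u hu) (hY u hu) (hUu.mono hXY) v
      have h2 := hβ.eq (Y u) (fderiv ℝ X u v)
      linarith [hYdX u hu v]
    have key : ∀ Z W : L u, (((a : Amb n →ₗ[ℝ] ℝ).smulRight ((L u).mkQ (fderiv ℝ X u v)) +
        (c : Amb n →ₗ[ℝ] ℝ).smulRight ((L u).mkQ (fderiv ℝ Y u v))).comp (L u).subtype) W ∈
          (LinearMap.ker (β (Z : Amb n))).map (L u).mkQ := by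
      rintro ⟨Z, hZ⟩ ⟨W, hW⟩
      refine ⟨a W • fderiv ℝ X u v + c W • fderiv ℝ Y u v, ?_, by simp⟩
      rw [hL u hu] at hZ
      obtain ⟨s, t, rfl⟩ := Submodule.mem_span_pair.1 hZ
      simp [hXdX, hXdY, hYdX u hu v, hYdY]
    exact ⟨fun Z => key Z Z, key⟩
  · intro hv h0
    apply hv
    apply himm u hu
    -- A vanishing velocity puts `dX(v)` in the line. Its coefficients there are its values under
    -- `a` and `c`, which are zero because both are constant along `X`.
    have := congrArg (fun f => f ⟨X u, hXu⟩) h0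
    obtain ⟨h1, h2, h3, h4⟩ := hd u hu
    simp [h1, h3] at this
    rw [hL u hu] at this
    rw [(hd u hu).eq_of_mem_span this,
      apply_fderiv_eq_zero a (hX u hu) (hUu.mono fun w hw => (hd w hw).1),
      apply_fderiv_eq_zero c (hX u hu) (hUu.mono fun w hw => (hd w hw).2.2.1)]
    simp

/-! ### Independence of the conservation laws -/

/-- A relation with coefficients `c` is the linear form with matrix `c` vanishing on all lines of
the system, and `g` carries it to a form vanishing on all generators. -/
lemma independent_iff_isNondegenerate {W V : Set (Par n)} {L : Par n → Submodule ℝ (Amb n)}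
    {S : LawSystem n} (hS : CorrespondsTo W L S V) : S.Independent V ↔ IsNondegenerate W L := by
  obtain ⟨g, φ, hsrc, htgt, -, -, hLg⟩ := hS
  have hsum (c : Fin (n + 4) → ℝ) :
      (∑ j, c j • (fun u : V => (S.p u j, S.r u j)) = 0) ↔
        ∀ u ∈ V, ∑ j, c j * S.p u j = 0 ∧ ∑ j, c j * S.r u j = 0 := by
    rw [funext_iff, Subtype.forall]
    refine forall₂_congr fun u hu => ?_
    simp [Finset.sum_apply, Prod.ext_iff, Prod.fst_sum, Prod.snd_sum]
  rw [LawSystem.Independent, Fintype.linearIndependent_iff]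
  constructor
  · intro hind H hH
    by_contra hne
    obtain ⟨ℓ, hℓ, hle⟩ := Submodule.exists_le_ker_of_lt_top H (lt_top_iff_ne_top.2 hne)
    apply hℓ
    have hx (x : Amb n) : ℓ (g x) = ∑ j, ℓ (g (Pi.single j 1)) * x j := by
      conv_lhs => rw [pi_eq_sum_univ' x]
      rw [map_sum, map_sum]
      refine Finset.sum_congr rfl fun j _ => ?_
      rw [map_smul, map_smul, smul_eq_mul, mul_comm]
    have hc := hind (fun j => ℓ (g (Pi.single j 1))) <| (hsum _).2 fun u hu => by
      have hw : φ.symm u ∈ W := hsrc ▸ φ.map_target (htgt ▸ hu)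
      have hL' := (hH _ hw).trans hle
      rw [hLg _ hw, φ.right_inv (htgt ▸ hu)] at hL'
      rw [← hx, ← hx]
      exact ⟨hL' ⟨_, Submodule.subset_span (by simp), rfl⟩,
        hL' ⟨_, Submodule.subset_span (by simp), rfl⟩⟩
    ext1 j
    have h0 (x : Amb n) : ℓ (g x) = 0 := by rw [hx]; simp [hc]
    ext
    simpa using h0 (g.symm (Pi.single j 1))
  · intro hnd c hc
    have hc' := (hsum c).1 hc
    let ℓ : Amb n →ₗ[ℝ] ℝ := Fintype.linearCombination ℝ c
    have hℓ (x : Amb n) : ℓ x = ∑ j, c j * x j := by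
      simp [ℓ, Fintype.linearCombination_apply, mul_comm]
    have htop := hnd (LinearMap.ker (ℓ ∘ₗ (g.symm : Amb n →ₗ[ℝ] Amb n))) fun w hw => by
      rw [hLg w hw, LawSystem.line, Submodule.map_span, Submodule.span_le]
      have hu : φ w ∈ V := htgt ▸ φ.map_source (hsrc ▸ hw)
      rintro _ ⟨x, rfl | rfl, rfl⟩
      · simpa [hℓ] using (hc' _ hu).1
      · simpa [hℓ] using (hc' _ hu).2
    intro j
    have : g (Pi.single j 1) ∈ LinearMap.ker (ℓ ∘ₗ (g.symm : Amb n →ₗ[ℝ] Amb n)) := by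
      rw [htop]; trivial
    simpa [hℓ, Pi.single_apply] using this

/-! ### The quadric of a Hamiltonian system -/

section Hamiltonian

variable {ε : Fin n → ℝ} {h : Par n → ℝ}

lemma isDualPair_line (S : LawSystem n) (u : Par n) : IsDualPair coordA coordD (S.p u) (S.r u) := by
  simp [IsDualPair, LawSystem.p, LawSystem.r]

lemma normalForm_p_p (u : Par n) : normalForm ε ((hamiltonianSystem ε h).p u)
    ((hamiltonianSystem ε h).p u) = 0 := by
  simp only [normalForm_apply, LawSystem.p, hamiltonianSystem, coordA_homVec, coordB_homVec,
    coordC_homVec, coordD_homVec, coordW_homVec, pow_two]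
  ring

lemma normalForm_p_r (hε : ∀ i, ε i = 1 ∨ ε i = -1) (u : Par n) :
    normalForm ε ((hamiltonianSystem ε h).p u) ((hamiltonianSystem ε h).r u) = 0 := by
  have (i : Fin n) : ε i * (u i * (ε i * partialDeriv h i u)) = partialDeriv h i u * u i := by
    rcases hε i with h' | h' <;> rw [h'] <;> ring
  simp only [normalForm_apply, LawSystem.p, LawSystem.r, hamiltonianSystem, coordA_homVec,
    coordB_homVec, coordC_homVec, coordD_homVec, coordW_homVec, this]
  ring

lemma normalForm_r_r (hε : ∀ i, ε i = 1 ∨ ε i = -1) (u : Par n) :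
    normalForm ε ((hamiltonianSystem ε h).r u) ((hamiltonianSystem ε h).r u) = 0 := by
  have (i : Fin n) : ε i * (ε i * partialDeriv h i u * (ε i * partialDeriv h i u)) =
      ε i * partialDeriv h i u ^ 2 := by
    rcases hε i with h' | h' <;> rw [h'] <;> ring
  simp only [normalForm_apply, LawSystem.r, hamiltonianSystem, coordA_homVec,
    coordB_homVec, coordC_homVec, coordD_homVec, coordW_homVec, this]
  ring

lemma differentiableAt_p {u : Par n} (hh : ContDiffAt ℝ ∞ h u) :
    DifferentiableAt ℝ (hamiltonianSystem ε h).p u := by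
  have : DifferentiableAt ℝ h u := hh.differentiableAt (by simp)
  refine differentiableAt_homVec (by fun_prop) (by fun_prop) ?_ this (by fun_prop)
  simp only [hamiltonianSystem]
  fun_prop

lemma differentiableAt_r {u : Par n} (hh : ContDiffAt ℝ ∞ h u) :
    DifferentiableAt ℝ (hamiltonianSystem ε h).r u := by
  have h1 : DifferentiableAt ℝ h u := hh.differentiableAt (by simp)
  have h2 : DifferentiableAt ℝ (fderiv ℝ h) u :=
    (hh.fderiv_right (m := 1) (by norm_cast)).differentiableAt (by simp)
  have h3 (i : Fin n) : DifferentiableAt ℝ (partialDeriv h i) u :=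
    h2.clm_apply (differentiableAt_const _)
  refine differentiableAt_homVec (by fun_prop) ?_ ?_ ?_ (by fun_prop) <;>
  · simp only [hamiltonianSystem]
    fun_prop

/-- The contact condition: since $(\varepsilon^i)^2=1$, the middle coordinates contribute $\sum
h_iv_i$, and the `C`–`D` pairing subtracts $dh(v)$. -/
lemma normalForm_r_fderiv_p (hε : ∀ i, ε i = 1 ∨ ε i = -1) {u : Par n}
    (hh : ContDiffAt ℝ ∞ h u) (v : Par n) :
    normalForm ε ((hamiltonianSystem ε h).r u) (fderiv ℝ (hamiltonianSystem ε h).p u v) = 0 := by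
  have hp := differentiableAt_p (ε := ε) hh
  have (i : Fin n) : ε i * (ε i * partialDeriv h i u * v i) = v i * partialDeriv h i u := by
    rcases hε i with h' | h' <;> rw [h'] <;> ring
  have hA : coordA (fderiv ℝ (hamiltonianSystem ε h).p u v) = 0 :=
    apply_fderiv_eq_zero coordA hp (c := 1) (by simp [LawSystem.p]) v
  have hD : coordD (fderiv ℝ (hamiltonianSystem ε h).p u v) = 0 :=
    apply_fderiv_eq_zero coordD hp (c := 0) (by simp [LawSystem.p]) v
  have hW : coordW (fderiv ℝ (hamiltonianSystem ε h).p u v) = v := by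
    rw [apply_fderiv coordW hp]
    simp [LawSystem.p]
  have hC : coordC (fderiv ℝ (hamiltonianSystem ε h).p u v) = ∑ i, v i * partialDeriv h i u := by
    rw [apply_fderiv coordC hp, ← fderiv_eq_sum_partialDeriv]
    simp [LawSystem.p, hamiltonianSystem]
  simp only [normalForm_apply, hA, hD, hW, hC]
  simp only [LawSystem.r, hamiltonianSystem, coordA_homVec,
    coordB_homVec, coordC_homVec, coordD_homVec, coordW_homVec, this]
  ring

lemma coordW_fderiv_p {u : Par n} (hh : ContDiffAt ℝ ∞ h u) (v : Par n) :
    coordW (fderiv ℝ (hamiltonianSystem ε h).p u v) = v := by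
  rw [apply_fderiv coordW (differentiableAt_p hh)]
  simp [LawSystem.p]

theorem exists_isLegendre_of_correspondsToHamiltonian {U : Set (Par n)}
    {L : Par n → Submodule ℝ (Amb n)} (hU : CorrespondsToHamiltonian U L) :
    ∃ β : LinearMap.BilinForm ℝ (Amb n), IsSmoothQuadric β ∧ IsLegendre U L β := by
  obtain ⟨ε, h, V, ⟨hε, hV, hh⟩, g, φ, hsrc, htgt, hφ, hφ', hLg⟩ := hU
  have hUo : IsOpen U := hsrc ▸ φ.open_source
  set β : LinearMap.BilinForm ℝ (Amb n) :=
    (normalForm ε).compl₁₂ (g.symm : Amb n →ₗ[ℝ] Amb n) (g.symm : Amb n →ₗ[ℝ] Amb n)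
  have hβ (x y) : β (g x) (g y) = normalForm ε x y := by simp [β]
  have hQ := isSmoothQuadric_of_normalForm hε g hβ
  let S := hamiltonianSystem ε h
  let G : Amb n ≃L[ℝ] Amb n := g.toContinuousLinearEquiv
  have hG (x) : G x = g x := rfl
  have hVu {u} (hu : u ∈ U) : φ u ∈ V := htgt ▸ φ.map_source (hsrc ▸ hu)
  have hhu {u} (hu : u ∈ U) : ContDiffAt ℝ ∞ h (φ u) := hh.contDiffAt (hV.mem_nhds (hVu hu))
  have hφu {u} (hu : u ∈ U) : DifferentiableAt ℝ φ u :=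
    (hφ.contDiffAt (hUo.mem_nhds hu)).differentiableAt (by simp)
  have hφV {u} (hu : u ∈ U) : DifferentiableAt ℝ φ.symm (φ u) :=
    (hφ'.contDiffAt (hV.mem_nhds (hVu hu))).differentiableAt (by simp)
  have hd1 {u} (hu : u ∈ U) : HasFDerivAt (fun w => G (S.p (φ w)))
      ((G : Amb n →L[ℝ] Amb n).comp ((fderiv ℝ S.p (φ u)).comp (fderiv ℝ φ u))) u :=
    G.hasFDerivAt.comp u ((differentiableAt_p (hhu hu)).hasFDerivAt.comp u (hφu hu).hasFDerivAt)
  have hd2 {u} (hu : u ∈ U) : DifferentiableAt ℝ (fun w => G (S.r (φ w))) u :=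
    G.differentiableAt.comp u ((differentiableAt_r (hhu hu)).comp u (hφu hu))
  refine ⟨β, hQ, isLegendre_of_dualPair hQ.1 (X := fun w => G (S.p (φ w)))
    (Y := fun w => G (S.r (φ w))) (a := coordA.comp (G.symm : Amb n →L[ℝ] Amb n))
    (c := coordD.comp (G.symm : Amb n →L[ℝ] Amb n)) hUo (fun u hu => (hd1 hu).differentiableAt)
    (fun u hu => hd2 hu) ?_ ?_ ?_ ?_ ?_ ?_ ?_⟩
  · intro u hu
    rw [hLg u hu, LawSystem.line, Submodule.map_span, Set.image_pair]
    rfl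
  · intro u hu
    simpa [IsDualPair] using isDualPair_line S (φ u)
  · intro u hu
    simp only [hG, hβ]
    exact normalForm_p_p _
  · intro u hu
    simp only [hG, hβ]
    exact normalForm_p_r hε _
  · intro u hu
    simp only [hG, hβ]
    exact normalForm_r_r hε _
  · intro u hu v
    rw [(hd1 hu).fderiv]
    simp only [ContinuousLinearMap.comp_apply, ContinuousLinearEquiv.coe_coe, hG, hβ]
    exact normalForm_r_fderiv_p hε (hhu hu) _
  · intro u hu v hv
    rw [(hd1 hu).fderiv] at hv
    simp only [ContinuousLinearMap.comp_apply, ContinuousLinearEquiv.coe_coe,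
      EmbeddingLike.map_eq_zero_iff] at hv
    -- The middle coordinates of `p` are the field variables themselves, so `p` is an immersion; the
    -- smooth inverse of `φ` then returns `v = 0`.
    have h1 : fderiv ℝ φ u v = 0 := by
      rw [← coordW_fderiv_p (ε := ε) (hhu hu) (fderiv ℝ φ u v)]
      simpa using congrArg coordW hv
    have h2 : fderiv ℝ (φ.symm ∘ φ) u = fderiv ℝ id u := by
      refine Filter.EventuallyEq.fderiv_eq ?_
      filter_upwards [hUo.mem_nhds hu] with w hw
      exact φ.left_inv (hsrc ▸ hw)
    rw [fderiv_comp u (hφV hu) (hφu hu), fderiv_id] at h2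
    simpa [h1] using (congrArg (fun f => f v) h2).symm

end Hamiltonian

/-! ### Reduction of a quadric containing a line to its normal form -/

/-- Sylvester's theorem for the quadratic form, carried over to the bilinear form by polarization.
-/
lemma exists_equiv_sum_signs {M : Type*} [AddCommGroup M] [Module ℝ M] [FiniteDimensional ℝ M]
    {B : LinearMap.BilinForm ℝ M} (hs : B.IsSymm) (hB : B.Nondegenerate)
    (hn : Module.finrank ℝ M = n) :
    ∃ ε : Fin n → ℝ, (∀ i, ε i = 1 ∨ ε i = -1) ∧ ∃ T : Par n ≃ₗ[ℝ] M,
      ∀ x y, B (T x) (T y) = ∑ i, ε i * (x i * y i) := by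
  subst hn
  have hassoc : QuadraticMap.associated (R := ℝ) (LinearMap.BilinMap.toQuadraticMap B) = B :=
    QuadraticMap.associated_left_inverse ℝ fun x y => (hs.eq x y)
  obtain ⟨w, hw, ⟨e⟩⟩ := QuadraticForm.equivalent_one_neg_one_weighted_sum_squared
    (LinearMap.BilinMap.toQuadraticMap B) (by rw [hassoc]; exact hB.1)
  refine ⟨w, fun i => (hw i).symm, e.symm.toLinearEquiv, fun x y => ?_⟩
  have hQ (z) : B (e.symm.toLinearEquiv z) (e.symm.toLinearEquiv z) = ∑ i, w i * (z i * z i) :=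
    (e.symm.map_app z).trans (by simp [QuadraticMap.weightedSumSquares_apply])
  have h1 := hQ (x + y)
  have h2 : B (e.symm.toLinearEquiv y) (e.symm.toLinearEquiv x) =
      B (e.symm.toLinearEquiv x) (e.symm.toLinearEquiv y) := hs.eq _ _
  have h3 : ∑ i, w i * ((x + y) i * (x + y) i) =
      ∑ i, w i * (x i * x i) + ∑ i, w i * (y i * y i) + 2 * ∑ i, w i * (x i * y i) := by
    rw [Finset.mul_sum, ← Finset.sum_add_distrib, ← Finset.sum_add_distrib]
    refine Finset.sum_congr rfl fun i _ => ?_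
    simp only [Pi.add_apply]
    ring
  simp only [map_add, LinearMap.add_apply, hQ x, hQ y, h2] at h1
  linarith

/-- Independence of `e` and `f` allows a functional with prescribed values on them; nondegeneracy
represents it by a vector. -/
lemma exists_apply_eq {β : LinearMap.BilinForm ℝ (Amb n)} (hβ : β.Nondegenerate) {e f : Amb n}
    (hli : LinearIndependent ℝ ![e, f]) (s t : ℝ) : ∃ x, β e x = s ∧ β f x = t := by
  obtain ⟨F, hF⟩ := LinearMap.exists_leftInverse_of_injective
    (Fintype.linearCombination ℝ ![e, f]) (LinearMap.ker_eq_bot'.2 fun c hc =>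
      funext (Fintype.linearIndependent_iff.1 hli c hc))
  have he : F e = Pi.single 0 1 := by
    simpa [Fintype.linearCombination_apply_single] using
      congrArg (fun G => G (Pi.single 0 1)) hF
  have hf : F f = Pi.single 1 1 := by
    simpa [Fintype.linearCombination_apply_single] using
      congrArg (fun G => G (Pi.single 1 1)) hF
  let ℓ : Module.Dual ℝ (Amb n) :=
    s • (LinearMap.proj 0 ∘ₗ F) + t • (LinearMap.proj 1 ∘ₗ F)
  have hinj : Function.Injective β.flip := by
    rw [← LinearMap.ker_eq_bot]
    exact LinearMap.separatingRight_iff_flip_ker_eq_bot.1 hβ.2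
  have hsurj : Function.Surjective β.flip :=
    (LinearMap.injective_iff_surjective_of_finrank_eq_finrank
      Subspace.dual_finrank_eq.symm).1 hinj
  obtain ⟨x, hx⟩ := hsurj ℓ
  refine ⟨x, ?_, ?_⟩
  · exact (LinearMap.congr_fun hx e).trans (by simp [ℓ, he])
  · exact (LinearMap.congr_fun hx f).trans (by simp [ℓ, hf])

/-- An isotropic plane completed to the sum of two hyperbolic planes. -/
lemma exists_hyperbolic_complement {β : LinearMap.BilinForm ℝ (Amb n)} (hβ : IsSmoothQuadric β)
    {e f : Amb n} (hli : LinearIndependent ℝ ![e, f]) (hee : β e e = 0) (hef : β e f = 0)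
    (hff : β f f = 0) :
    ∃ e' f' : Amb n, β e e' = -1 ∧ β f e' = 0 ∧ β e f' = 0 ∧ β f f' = -1 ∧
      β e' e' = 0 ∧ β e' f' = 0 ∧ β f' f' = 0 := by
  have hs (x y) : β x y = β y x := hβ.1.eq x y
  obtain ⟨e₁, h1, h2⟩ := exists_apply_eq hβ.2 hli (-1) 0
  obtain ⟨f₁, h3, h4⟩ := exists_apply_eq hβ.2 hli 0 (-1)
  have hfe : β f e = 0 := hs e f ▸ hef
  have h1' := hs e e₁ ▸ h1
  have h2' := hs f e₁ ▸ h2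
  have h3' := hs e f₁ ▸ h3
  have h4' := hs f f₁ ▸ h4
  have h5 := hs e₁ f₁
  -- Because $(e,e_1)=(f,f_1)=-1$, adding multiples of `e` and `f` corrects the three products of
  -- `e₁, f₁` to zero without changing their products with `e, f`.
  refine ⟨e₁ + (β e₁ e₁ / 2) • e, f₁ + β e₁ f₁ • e + (β f₁ f₁ / 2) • f, ?_, ?_, ?_, ?_, ?_, ?_, ?_⟩
  all_goals
    simp [h1, h2, h3, h4, h1', h2', h3', h4', hee, hef, hff, hfe]
  all_goals ring

/-- The two hyperbolic planes through `e` and `f` split off, and their orthogonal complement is a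
nondegenerate space of dimension `n`, which is diagonalized. -/
theorem exists_equiv_normalForm {β : LinearMap.BilinForm ℝ (Amb n)} (hβ : IsSmoothQuadric β)
    {e f : Amb n} (hli : LinearIndependent ℝ ![e, f]) (hee : β e e = 0) (hef : β e f = 0)
    (hff : β f f = 0) :
    ∃ ε : Fin n → ℝ, (∀ i, ε i = 1 ∨ ε i = -1) ∧ ∃ g : Amb n ≃ₗ[ℝ] Amb n,
      g (homVec 1 0 0 0 0) = e ∧ g (homVec 0 0 0 0 1) = f ∧
        ∀ x y, β (g x) (g y) = normalForm ε x y := by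
  have hs (x y) : β x y = β y x := hβ.1.eq x y
  have hrefl : β.IsRefl := fun x y h => hs x y ▸ h
  obtain ⟨e', f', h1, h2, h3, h4, h5, h6, h7⟩ := exists_hyperbolic_complement hβ hli hee hef hff
  have hfe := hs e f ▸ hef
  have h1' := hs e e' ▸ h1
  have h2' := hs f e' ▸ h2
  have h3' := hs e f' ▸ h3
  have h4' := hs f f' ▸ h4
  have h6' := hs e' f' ▸ h6
  let b : Fin 4 → Amb n := ![e, f, e', f']
  have hcomb (c : Fin 4 → ℝ) : ∑ i, c i • b i = c 0 • e + c 1 • f + c 2 • e' + c 3 • f' := by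
    simp [b, Fin.sum_univ_four]
  -- The Gram matrix of the four vectors is invertible. This gives both their independence and the
  -- nondegeneracy of their span.
  have horth (c : Fin 4 → ℝ) (h : ∀ i, β (b i) (∑ i, c i • b i) = 0) : c = 0 := by
    rw [hcomb] at h
    have g0 := h 0
    have g1 := h 1
    have g2 := h 2
    have g3 := h 3
    simp [b, h1, h2, h3, h4, h1', h2', h3', h4', hee, hef, hff, hfe, h5, h6, h6', h7]
      at g0 g1 g2 g3
    ext i
    fin_cases i <;> simp [*]
  have hbli : LinearIndependent ℝ b := by
    rw [Fintype.linearIndependent_iff]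
    intro c hc
    exact congrFun (horth c fun i => by rw [hc, map_zero])
  set H := Submodule.span ℝ (Set.range b)
  set K := β.orthogonal H
  have hbH (i) : b i ∈ H := Submodule.subset_span ⟨i, rfl⟩
  have hK : Module.finrank ℝ K = n := by
    rw [LinearMap.BilinForm.finrank_orthogonal hβ.2, finrank_span_eq_card hbli]
    simp
  have hdisj : Disjoint K (β.orthogonal K) := by
    rw [LinearMap.BilinForm.orthogonal_orthogonal hβ.2 hrefl, Submodule.disjoint_def]
    intro x hxK hxH
    obtain ⟨c, rfl⟩ := (Submodule.mem_span_range_iff_exists_fun ℝ).1 hxH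
    rw [horth c fun i => LinearMap.BilinForm.mem_orthogonal_iff.1 hxK _ (hbH i)]
    simp
  have hKs : (β.restrict K).IsSymm := ⟨fun x y => hβ.1.eq x y⟩
  obtain ⟨ε, hε, T, hT⟩ := exists_equiv_sum_signs hKs
    (LinearMap.BilinForm.nondegenerate_restrict_of_disjoint_orthogonal β hrefl hdisj) hK
  have hT' (x y) : β (T x) (T y) = ∑ i, ε i * (x i * y i) := hT x y
  have hbT (i x) : β (b i) (T x) = 0 :=
    LinearMap.BilinForm.mem_orthogonal_iff.1 (T x).2 _ (hbH i)
  have hTb (i x) : β (T x) (b i) = 0 := by rw [hs]; exact hbT i x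
  have k0 := hbT 0
  have k1 := hbT 1
  have k2 := hbT 2
  have k3 := hbT 3
  have k0' := hTb 0
  have k1' := hTb 1
  have k2' := hTb 2
  have k3' := hTb 3
  simp [b] at k0 k1 k2 k3 k0' k1' k2' k3'
  let G : Amb n →ₗ[ℝ] Amb n :=
    coordA.toLinearMap.smulRight e + coordD.toLinearMap.smulRight f +
    coordB.toLinearMap.smulRight e' + coordC.toLinearMap.smulRight f' +
    K.subtype ∘ₗ (T : Par n →ₗ[ℝ] K) ∘ₗ coordW.toLinearMap
  have hG (x) : G x = coordA x • e + coordD x • f + coordB x • e' + coordC x • f' +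
      (T (coordW x) : Amb n) := by simp [G]
  have hGβ (x y) : β (G x) (G y) = normalForm ε x y := by
    rw [hG, hG, normalForm_apply]
    simp [h1, h2, h3, h4, h1', h2', h3', h4', hee, hef, hff, hfe, h5, h6, h6', h7,
      k0, k1, k2, k3, k0', k1', k2', k3', hT']
    ring
  have hinj : Function.Injective G := by
    rw [← LinearMap.ker_eq_bot, LinearMap.ker_eq_bot']
    -- A map that pulls `β` back to a nondegenerate form has trivial kernel.
    intro x hx
    exact eq_zero_of_normalForm_eq_zero hε fun y => by rw [← hGβ, hx]; simp
  refine ⟨ε, hε, LinearEquiv.ofInjectiveEndo G hinj, ?_, ?_, hGβ⟩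
  · rw [LinearEquiv.coe_ofInjectiveEndo, hG]; simp
  · rw [LinearEquiv.coe_ofInjectiveEndo, hG]; simp

/-! ### Hamiltonian systems from Legendre families -/

lemma linearIndependent_pair_comb {X Y : Amb n} (h : LinearIndependent ℝ ![X, Y])
    {a b c d : ℝ} (hdet : a * d - b * c ≠ 0) :
    LinearIndependent ℝ ![a • X + b • Y, c • X + d • Y] := by
  rw [LinearIndependent.pair_iff] at h ⊢
  intro s t hst
  obtain ⟨h1, h2⟩ := h (s * a + t * c) (s * b + t * d) (by rw [← hst]; module)
  constructor
  · exact (mul_eq_zero.1 (by linear_combination d * h1 - c * h2 : s * (a * d - b * c) = 0)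
      ).resolve_right hdet
  · exact (mul_eq_zero.1 (by linear_combination a * h2 - b * h1 : t * (a * d - b * c) = 0)
      ).resolve_right hdet

lemma span_pair_comb {X Y : Amb n} {a b c d : ℝ} (hdet : a * d - b * c ≠ 0) :
    Submodule.span ℝ {X, Y} = Submodule.span ℝ {a • X + b • Y, c • X + d • Y} := by
  have hk := mul_inv_cancel₀ hdet
  apply le_antisymm
  · rw [Submodule.span_le]
    rintro _ (rfl | rfl) <;> rw [SetLike.mem_coe, Submodule.mem_span_pair]
    · refine ⟨d * (a * d - b * c)⁻¹, -b * (a * d - b * c)⁻¹, ?_⟩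
      match_scalars <;> first | ring1 | linear_combination hk
    · refine ⟨-c * (a * d - b * c)⁻¹, a * (a * d - b * c)⁻¹, ?_⟩
      match_scalars <;> first | ring1 | linear_combination hk
  · rw [Submodule.span_le]
    rintro _ (rfl | rfl) <;> rw [SetLike.mem_coe, Submodule.mem_span_pair]
    exacts [⟨a, b, rfl⟩, ⟨c, d, rfl⟩]

lemma IsSmoothFrame.comb {W W' : Set (Par n)} {L : Par n → Submodule ℝ (Amb n)}
    {X Y : Par n → Amb n} (h : IsSmoothFrame W L X Y) (hW : W' ⊆ W) {a b c d : Par n → ℝ}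
    (ha : ContDiffOn ℝ ∞ a W') (hb : ContDiffOn ℝ ∞ b W') (hc : ContDiffOn ℝ ∞ c W')
    (hd : ContDiffOn ℝ ∞ d W') (hdet : ∀ w ∈ W', a w * d w - b w * c w ≠ 0) :
    IsSmoothFrame W' L (fun w => a w • X w + b w • Y w) (fun w => c w • X w + d w • Y w) := by
  obtain ⟨hX, hY, hL⟩ := h
  replace hX := hX.mono hW
  replace hY := hY.mono hW
  exact ⟨(ha.smul hX).add (hb.smul hY), (hc.smul hX).add (hd.smul hY), fun w hw =>
    ⟨linearIndependent_pair_comb (hL w (hW hw)).1 (hdet w hw), by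
      rw [(hL w (hW hw)).2, span_pair_comb (hdet w hw)]⟩⟩

/-- A frame whose first vector describes an immersed submanifold transversal to the line. -/
lemma exists_transversal_frame {W : Set (Par n)} {L : Par n → Submodule ℝ (Amb n)}
    {X Y : Par n → Amb n} (h : IsSmoothFrame W L X Y) (hW : IsOpen W) {u : Par n} (hu : u ∈ W)
    (hs : SweepsOut X Y u) :
    ∃ P R : Par n → Amb n, IsSmoothFrame W L P R ∧ ∀ v, fderiv ℝ P u v ∈ L u → v = 0 := by
  obtain ⟨a, b, hinj⟩ := hs
  have hX : DifferentiableAt ℝ X u := (h.1.contDiffAt (hW.mem_nhds hu)).differentiableAt (by simp)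
  have hY : DifferentiableAt ℝ Y u :=
    (h.2.1.contDiffAt (hW.mem_nhds hu)).differentiableAt (by simp)
  have hder (v : Par n) (s t : ℝ) :
      fderiv ℝ (fun q : Par n × ℝ × ℝ => q.2.1 • X q.1 + q.2.2 • Y q.1) (u, a, b) (v, s, t) =
        a • fderiv ℝ X u v + b • fderiv ℝ Y u v + (s • X u + t • Y u) := by
    have h1 : HasFDerivAt (fun q : Par n × ℝ × ℝ => X q.1) _ (u, a, b) :=
      HasFDerivAt.comp (u, a, b) (g := X) (f := Prod.fst) hX.hasFDerivAt hasFDerivAt_fst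
    have h2 : HasFDerivAt (fun q : Par n × ℝ × ℝ => Y q.1) _ (u, a, b) :=
      HasFDerivAt.comp (u, a, b) (g := Y) (f := Prod.fst) hY.hasFDerivAt hasFDerivAt_fst
    have h3 : HasFDerivAt (fun q : Par n × ℝ × ℝ => q.2.1) _ (u, a, b) :=
      ((ContinuousLinearMap.fst ℝ ℝ ℝ).comp (ContinuousLinearMap.snd ℝ (Par n) (ℝ × ℝ))).hasFDerivAt
    have h4 : HasFDerivAt (fun q : Par n × ℝ × ℝ => q.2.2) _ (u, a, b) :=
      ((ContinuousLinearMap.snd ℝ ℝ ℝ).comp (ContinuousLinearMap.snd ℝ (Par n) (ℝ × ℝ))).hasFDerivAt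
    rw [((h3.fun_smul h1).fun_add (h4.fun_smul h2)).fderiv]
    simp
    abel
  have hfd (v : Par n) (hv : a • fderiv ℝ X u v + b • fderiv ℝ Y u v ∈ L u) : v = 0 := by
    rw [(h.2.2 u hu).2] at hv
    obtain ⟨s, t, hst⟩ := Submodule.mem_span_pair.1 hv
    have := @hinj (v, -s, -t) 0 (by rw [hder, map_zero, ← hst]; module)
    exact congrArg Prod.fst this
  have hfdP : fderiv ℝ (fun w => a • X w + b • Y w) u =
      a • fderiv ℝ X u + b • fderiv ℝ Y u :=
    ((hX.hasFDerivAt.const_smul a).add (hY.hasFDerivAt.const_smul b)).fderiv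
  have hc (x : ℝ) : ContDiffOn ℝ ∞ (fun _ : Par n => x) W := contDiffOn_const
  by_cases ha : a = 0
  · by_cases hb : b = 0
    -- At `a = b = 0` the sweeping derivative ignores `v`, so its injectivity forces `n = 0` and any
    -- frame works.
    · refine ⟨X, Y, h, fun v _ => hfd v ?_⟩
      simp [ha, hb]
    · refine ⟨_, _, h.comb subset_rfl (hc a) (hc b) (hc 1) (hc 0)
        (fun _ _ => by simpa using hb), ?_⟩
      intro v hv
      rw [hfdP] at hv
      exact hfd v hv
  · refine ⟨_, _, h.comb subset_rfl (hc a) (hc b) (hc 0) (hc 1) (fun _ _ => by simpa using ha), ?_⟩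
    intro v hv
    rw [hfdP] at hv
    exact hfd v hv

/-! ### Isotropy and contact in terms of a frame -/

section Legendre

variable {W : Set (Par n)} {L : Par n → Submodule ℝ (Amb n)} {X Y : Par n → Amb n}
  {β : LinearMap.BilinForm ℝ (Amb n)}

lemma IsSmoothFrame.mem (h : IsSmoothFrame W L X Y) {u : Par n} (hu : u ∈ W) :
    X u ∈ L u ∧ Y u ∈ L u := by
  rw [(h.2.2 u hu).2]
  exact ⟨Submodule.subset_span (by simp), Submodule.subset_span (by simp)⟩

lemma IsLegendre.mono {W' : Set (Par n)} (h : IsLegendre W L β) (hW : W' ⊆ W) :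
    IsLegendre W' L β := fun u hu => h u (hW hu)

lemma apply_eq_zero_of_mem_fano (hβ : β.IsSymm) {Λ : Submodule ℝ (Amb n)} (hΛ : Λ ∈ fano β)
    {x y : Amb n} (hx : x ∈ Λ) (hy : y ∈ Λ) : β x y = 0 := by
  have h := hΛ.2 _ (Λ.add_mem hx hy)
  have h1 : β x y = β y x := hβ.eq x y
  simp only [map_add, LinearMap.add_apply, hΛ.2 x hx, hΛ.2 y hy] at h
  linarith

/-- Contact only provides some representative of the class of `dX(v)` that is orthogonal to `Y`; it
differs from `dX(v)` by a vector of the isotropic line, which is also orthogonal to `Y`. -/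
lemma IsLegendre.apply_fderiv_eq_zero (h : IsLegendre W L β) (hβ : β.IsSymm) (hW : IsOpen W)
    (hF : IsSmoothFrame W L X Y) {u : Par n} (hu : u ∈ W) (v : Par n) :
    β (Y u) (fderiv ℝ X u v) = 0 := by
  obtain ⟨hfano, hvel⟩ := h u hu
  obtain ⟨φ, hφ, hcon, -⟩ := hvel v
  have hmem := hF.mem hu
  have hX : DifferentiableAt ℝ X u :=
    (hF.1.contDiffAt (hW.mem_nhds hu)).differentiableAt (by simp)
  obtain ⟨z, hz, hzX⟩ := hcon.2 ⟨Y u, hmem.2⟩ ⟨X u, hmem.1⟩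
  rw [hφ X hX (Filter.mem_of_superset (hW.mem_nhds hu) fun w hw => (hF.mem hw).1)] at hzX
  have hdiff : z - fderiv ℝ X u v ∈ L u := (Submodule.Quotient.eq _).1 hzX
  have h1 := apply_eq_zero_of_mem_fano hβ hfano hmem.2 hdiff
  have h2 : β (Y u) z = 0 := hz
  rw [map_sub, h2] at h1
  linarith

end Legendre

/-! ### Local inversion of the field variables -/

section InverseFunction

variable {E : Type*} [NormedAddCommGroup E] [NormedSpace ℝ E] [CompleteSpace E]

/-- The inverse function theorem, with smoothness of the inverse on the whole target. -/
lemma exists_openPartialHomeomorph_of_injective_fderiv [FiniteDimensional ℝ E] {W : Set E}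
    (hW : IsOpen W) {f : E → E} (hf : ContDiffOn ℝ ∞ f W) {u : E} (hu : u ∈ W)
    (hinj : ∀ v, fderiv ℝ f u v = 0 → v = 0) :
    ∃ φ : OpenPartialHomeomorph E E, ⇑φ = f ∧ u ∈ φ.source ∧ φ.source ⊆ W ∧
      ContDiffOn ℝ ∞ φ.symm φ.target ∧
      ∀ w ∈ φ.source, Function.Surjective (fderiv ℝ f w) := by
  have hfw {w} (hw : w ∈ W) : ContDiffAt ℝ ∞ f w := hf.contDiffAt (hW.mem_nhds hw)
  have hdw {w} (hw : w ∈ W) : HasFDerivAt f (fderiv ℝ f w) w :=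
    ((hfw hw).differentiableAt (by simp)).hasFDerivAt
  let F : E ≃L[ℝ] E := (LinearEquiv.ofInjectiveEndo (fderiv ℝ f u : E →ₗ[ℝ] E) <|
    LinearMap.ker_eq_bot.1 (LinearMap.ker_eq_bot'.2 hinj)).toContinuousLinearEquiv
  have hF : (F : E →L[ℝ] E) = fderiv ℝ f u := by ext; rfl
  let φ₀ := (hfw hu).toOpenPartialHomeomorph f (f' := F) (hF ▸ hdw hu) (by simp)
  -- The open set where the derivative is invertible; restricting to it makes the inverse smooth at
  -- every point of the target, not only at the image of `u`.
  let O : Set E := W ∩ fderiv ℝ f ⁻¹' Set.range ((↑) : (E ≃L[ℝ] E) → E →L[ℝ] E)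
  have hO : IsOpen O :=
    (hf.continuousOn_fderiv_of_isOpen hW (by simp)).isOpen_inter_preimage hW
      ContinuousLinearEquiv.isOpen
  have hsrc : (φ₀.restrOpen O hO).source = φ₀.source ∩ O := φ₀.restrOpen_source O hO
  refine ⟨φ₀.restrOpen O hO, rfl, ?_, ?_, ?_, ?_⟩
  · rw [hsrc]
    exact ⟨(hfw hu).mem_toOpenPartialHomeomorph_source _ _, hu, F, hF⟩
  · rw [hsrc]
    exact fun w hw => hw.2.1
  · intro y hy
    have hw := (φ₀.restrOpen O hO).map_target hy
    have hw' := hw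
    rw [hsrc] at hw'
    obtain ⟨-, hwW, A, hA⟩ := hw'
    exact ((φ₀.restrOpen O hO).contDiffAt_symm (f₀' := A) hy (hA ▸ hdw hwW)
      (hfw hwW)).contDiffWithinAt
  · intro w hw
    rw [hsrc] at hw
    obtain ⟨-, -, A, hA⟩ := hw
    rw [← hA]
    exact A.surjective

end InverseFunction

section

variable {W : Set (Par n)} {L : Par n → Submodule ℝ (Amb n)} {X Y : Par n → Amb n}
  {β : LinearMap.BilinForm ℝ (Amb n)}

/-- A Legendre family in normal form is the family of lines of a Hamiltonian system. -/
lemma correspondsToHamiltonian_of_normalForm (hβ : β.IsSymm) (hleg : IsLegendre W L β)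
    (hW : IsOpen W) (hF : IsSmoothFrame W L X Y) {ε : Fin n → ℝ} (hε : ∀ i, ε i = 1 ∨ ε i = -1)
    (g : Amb n ≃L[ℝ] Amb n) (hg : ∀ x y, β (g x) (g y) = normalForm ε x y)
    (hdual : ∀ w ∈ W, IsDualPair coordA coordD (g.symm (X w)) (g.symm (Y w)))
    {u : Par n} (hu : u ∈ W) (hXu : g.symm (X u) = homVec 1 0 0 0 0)
    (himm : ∀ v, fderiv ℝ X u v = 0 → v = 0) :
    ∃ W' : Set (Par n), IsOpen W' ∧ u ∈ W' ∧ W' ⊆ W ∧ CorrespondsToHamiltonian W' L := by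
  set p : Par n → Amb n := fun w => g.symm (X w)
  set r : Par n → Amb n := fun w => g.symm (Y w)
  have hWn {w} (hw : w ∈ W) : ∀ᶠ y in 𝓝 w, y ∈ W := hW.mem_nhds hw
  have hpW : ContDiffOn ℝ ∞ p W := g.symm.contDiff.comp_contDiffOn hF.1
  have hX {w} (hw : w ∈ W) : DifferentiableAt ℝ X w :=
    (hF.1.contDiffAt (hWn hw)).differentiableAt (by simp)
  have hp {w} (hw : w ∈ W) : DifferentiableAt ℝ p w :=
    (hpW.contDiffAt (hWn hw)).differentiableAt (by simp)
  have hnf (x y : Amb n) : normalForm ε (g.symm x) (g.symm y) = β x y := by simp [← hg]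
  have hpp {w} (hw : w ∈ W) : normalForm ε (p w) (p w) = 0 := by
    rw [hnf]
    exact apply_eq_zero_of_mem_fano hβ (hleg w hw).1 (hF.mem hw).1 (hF.mem hw).1
  have hpr {w} (hw : w ∈ W) : normalForm ε (p w) (r w) = 0 := by
    rw [hnf]
    exact apply_eq_zero_of_mem_fano hβ (hleg w hw).1 (hF.mem hw).1 (hF.mem hw).2
  have hrr {w} (hw : w ∈ W) : normalForm ε (r w) (r w) = 0 := by
    rw [hnf]
    exact apply_eq_zero_of_mem_fano hβ (hleg w hw).1 (hF.mem hw).2 (hF.mem hw).2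
  have hdp {w} (hw : w ∈ W) (v) : fderiv ℝ p w v = g.symm (fderiv ℝ X w v) :=
    (apply_fderiv (g.symm : Amb n →L[ℝ] Amb n) (hX hw) v).symm
  have hrdp {w} (hw : w ∈ W) (v) : normalForm ε (r w) (fderiv ℝ p w v) = 0 := by
    rw [hdp hw, hnf]
    exact hleg.apply_fderiv_eq_zero hβ hW hF hw v
  have hdA {w} (hw : w ∈ W) (v) : coordA (fderiv ℝ p w v) = 0 :=
    apply_fderiv_eq_zero coordA (hp hw) ((hWn hw).mono fun y hy => (hdual y hy).1) v
  have hdD {w} (hw : w ∈ W) (v) : coordD (fderiv ℝ p w v) = 0 :=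
    apply_fderiv_eq_zero coordD (hp hw) ((hWn hw).mono fun y hy => (hdual y hy).2.2.1) v
  -- The contact condition solved for the `C` coordinate: it becomes $dh=\sum\varepsilon^ir^i\,du^i$
  -- once that coordinate is named `h`.
  have hdC {w} (hw : w ∈ W) (v) : coordC (fderiv ℝ p w v) =
      ∑ i, ε i * (coordW (r w) i * coordW (fderiv ℝ p w v) i) := by
    have h := hrdp hw v
    rw [normalForm_apply, hdA hw, hdD hw, (hdual w hw).2.1, (hdual w hw).2.2.2] at h
    linarith
  let ψ : Par n → Par n := fun w => coordW (p w)
  have hψW : ContDiffOn ℝ ∞ ψ W := coordW.contDiff.comp_contDiffOn hpW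
  have hdψ {w} (hw : w ∈ W) (v) : fderiv ℝ ψ w v = coordW (fderiv ℝ p w v) :=
    (apply_fderiv coordW (hp hw) v).symm
  obtain ⟨φ, hφψ, huφ, hφW, hφsymm, hsurj⟩ :=
    exists_openPartialHomeomorph_of_injective_fderiv hW hψW hu fun v hv => by
      apply himm
      rw [hdψ hu] at hv
      -- At `u` the point `p` is the first basis vector, so $(p,dp)=0$ involves only the `B`
      -- coordinate of `dp`.
      have hB : coordB (fderiv ℝ p u v) = 0 := by
        have h := bilin_fderiv_eq_zero (normalForm ε) (hp hu) (hp hu)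
          ((hWn hu).mono fun y hy => hpp hy) v
        rw [normalForm_comm ε _ (p u), show p u = _ from hXu, normalForm_apply, hdD hu] at h
        simpa using h
      have hC : coordC (fderiv ℝ p u v) = 0 := by rw [hdC hu, hv]; simp
      have h0 : fderiv ℝ p u v = 0 :=
        amb_ext (by simp [hdA hu]) (by simp [hv]) (by simp [hB]) (by simp [hC]) (by simp [hdD hu])
      rwa [hdp hu, EmbeddingLike.map_eq_zero_iff] at h0
  let h : Par n → ℝ := fun y => coordC (p (φ.symm y))
  have hmaps : Set.MapsTo φ.symm φ.target W := fun y hy => hφW (φ.map_target hy)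
  have hh : ContDiffOn ℝ ∞ h φ.target :=
    (coordC (n := n)).contDiff.comp_contDiffOn (hpW.comp hφsymm hmaps)
  have hφw (w) : φ w = coordW (p w) := congrFun hφψ w
  have hhφ {w} (hw : w ∈ φ.source) : h (φ w) = coordC (p w) := by simp [h, φ.left_inv hw]
  have hpart {w} (hw : w ∈ φ.source) (i) : ε i * partialDeriv h i (φ w) = coordW (r w) i := by
    have hwW := hφW hw
    -- The direction along which only the `i`-th field variable changes, to first order; `hdC` along
    -- it isolates $h_i$.
    obtain ⟨v, hv⟩ := hsurj w hw (Pi.single i 1)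
    have h1 : fderiv ℝ (h ∘ φ) w v = coordC (fderiv ℝ p w v) := by
      rw [apply_fderiv coordC (hp hwW)]
      refine congrArg (fun f : Par n →L[ℝ] ℝ => f v) (Filter.EventuallyEq.fderiv_eq ?_)
      filter_upwards [φ.open_source.mem_nhds hw] with y hy using hhφ hy
    have h2 : DifferentiableAt ℝ h (φ w) :=
      (hh.contDiffAt (φ.open_target.mem_nhds (φ.map_source hw))).differentiableAt (by simp)
    have h3 : DifferentiableAt ℝ φ w := by
      rw [hφψ]
      exact (hψW.contDiffAt (hWn hwW)).differentiableAt (by simp)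
    rw [fderiv_comp w h2 h3, ContinuousLinearMap.comp_apply, hφψ, hv, hdC hwW, ← hdψ hwW, hv]
      at h1
    rw [partialDeriv, hφψ, h1]
    simp only [Pi.single_apply]
    rcases hε i with h' | h' <;> simp [h']
  have hSp {w} (hw : w ∈ φ.source) : (hamiltonianSystem ε h).p (φ w) = p w := by
    have h1 := hpp (hφW hw)
    obtain ⟨hA, -, hD, -⟩ := hdual w (hφW hw)
    rw [normalForm_apply, hA, hD] at h1
    apply amb_ext <;> simp only [LawSystem.p, hamiltonianSystem, coordA_homVec, coordB_homVec,
      coordC_homVec, coordD_homVec, coordW_homVec, hφw, pow_two]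
    · exact hA.symm
    · linarith
    · rw [← hφw, hhφ hw]
    · exact hD.symm
  have hSr {w} (hw : w ∈ φ.source) : (hamiltonianSystem ε h).r (φ w) = r w := by
    have h1 := hpr (hφW hw)
    have h2 := hrr (hφW hw)
    obtain ⟨hA, hA', hD, hD'⟩ := hdual w (hφW hw)
    rw [normalForm_apply, hA, hD, hA', hD'] at h1
    rw [normalForm_apply, hA', hD'] at h2
    have h3 (i) : partialDeriv h i (φ w) = ε i * coordW (r w) i := by
      rw [← hpart hw]
      rcases hε i with h' | h' <;> simp [h']
    apply amb_ext <;> simp only [LawSystem.r, hamiltonianSystem, coordA_homVec, coordB_homVec,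
      coordC_homVec, coordD_homVec, coordW_homVec]
    · exact hA'.symm
    · exact funext (hpart hw)
    · have h4 : ∑ i, partialDeriv h i (φ w) * φ w i =
          ∑ i, ε i * (coordW (p w) i * coordW (r w) i) :=
        Finset.sum_congr rfl fun i _ => by rw [h3, hφw]; ring
      rw [h4, hhφ hw]
      linarith
    · have h4 : ∑ i, ε i * partialDeriv h i (φ w) ^ 2 =
          ∑ i, ε i * (coordW (r w) i * coordW (r w) i) :=
        Finset.sum_congr rfl fun i _ => by
          rw [h3]
          rcases hε i with h' | h' <;> rw [h'] <;> ring
      rw [h4]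
      linarith
    · exact hD'.symm
  refine ⟨φ.source, φ.open_source, huφ, hφW, ε, h, φ.target, ⟨hε, φ.open_target, hh⟩,
    g.toLinearEquiv, φ, rfl, rfl, ?_, hφsymm, fun w hw => ?_⟩
  · rw [hφψ]
    exact hψW.mono hφW
  · rw [LawSystem.line, Submodule.map_span, Set.image_pair, hSp hw, hSr hw, (hF.2.2 w (hφW hw)).2]
    simp [p, r]

/-- What remains is to normalize a transversal frame near `u` so that it is dual to the first and
last coordinates, without losing transversality. -/
theorem exists_correspondsToHamiltonian_of_isLegendre (hβ : IsSmoothQuadric β)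
    (hleg : IsLegendre W L β) (hW : IsOpen W) (hF : IsSmoothFrame W L X Y) {u : Par n}
    (hu : u ∈ W) (hs : SweepsOut X Y u) :
    ∃ W' : Set (Par n), IsOpen W' ∧ u ∈ W' ∧ W' ⊆ W ∧ CorrespondsToHamiltonian W' L := by
  obtain ⟨P, R, hPR, htrans⟩ := exists_transversal_frame hF hW hu hs
  have hiso {x y} (hx : x ∈ L u) (hy : y ∈ L u) : β x y = 0 :=
    apply_eq_zero_of_mem_fano hβ.1 (hleg u hu).1 hx hy
  obtain ⟨hP, hR⟩ := hPR.mem hu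
  obtain ⟨ε, hε, g₀, hgP, hgR, hg⟩ := exists_equiv_normalForm hβ (hPR.2.2 u hu).1
    (hiso hP hP) (hiso hP hR) (hiso hR hR)
  let g := g₀.toContinuousLinearEquiv
  have hPu : g.symm (P u) = homVec 1 0 0 0 0 := g.symm_apply_eq.2 hgP.symm
  have hRu : g.symm (R u) = homVec 0 0 0 0 1 := g.symm_apply_eq.2 hgR.symm
  -- The determinant of the first and last coordinates of the frame. It equals 1 at `u`, and where
  -- it is nonzero Cramer's rule supplies the dual frame.
  let Δ : Par n → ℝ := fun w => coordA (g.symm (P w)) * coordD (g.symm (R w)) -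
    coordD (g.symm (P w)) * coordA (g.symm (R w))
  have hc (ℓ : Amb n →L[ℝ] ℝ) {Z : Par n → Amb n} (hZ : ContDiffOn ℝ ∞ Z W) :
      ContDiffOn ℝ ∞ (fun w => ℓ (g.symm (Z w))) W :=
    (ℓ.contDiff.comp g.symm.contDiff).comp_contDiffOn hZ
  have hΔ : ContDiffOn ℝ ∞ Δ W :=
    ((hc _ hPR.1).mul (hc _ hPR.2.1)).sub ((hc _ hPR.1).mul (hc _ hPR.2.1))
  have hΔu : Δ u = 1 := by simp [Δ, hPu, hRu]
  let W₁ : Set (Par n) := W ∩ Δ ⁻¹' {0}ᶜ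
  have hW₁ : IsOpen W₁ := hΔ.continuousOn.isOpen_inter_preimage hW isOpen_compl_singleton
  have hsub : W₁ ⊆ W := Set.inter_subset_left
  have hu₁ : u ∈ W₁ := ⟨hu, by simp [hΔu]⟩
  have hcoef (ℓ : Amb n →L[ℝ] ℝ) {Z : Par n → Amb n} (hZ : ContDiffOn ℝ ∞ Z W) :
      ContDiffOn ℝ ∞ (fun w => ℓ (g.symm (Z w)) / Δ w) W₁ :=
    ((hc ℓ hZ).mono hsub).div (hΔ.mono hsub) fun w hw => hw.2
  have ha := hcoef coordD hPR.2.1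
  have hb := (hcoef coordD hPR.1).neg
  have hF₁ := hPR.comb hsub ha hb (hcoef coordA hPR.2.1).neg (hcoef coordA hPR.1) <| by
    intro w hw
    have hw0 : Δ w ≠ 0 := hw.2
    have : coordD (g.symm (R w)) / Δ w * (coordA (g.symm (P w)) / Δ w) -
        -(coordD (g.symm (P w)) / Δ w) * -(coordA (g.symm (R w)) / Δ w) = (Δ w)⁻¹ := by
      field_simp
      simp only [Δ]
      ring
    rw [this]
    exact inv_ne_zero hw0
  refine Exists.imp (fun W' h => ⟨h.1, h.2.1, h.2.2.1.trans hsub, h.2.2.2⟩)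
    (correspondsToHamiltonian_of_normalForm hβ.1 (hleg.mono hsub) hW₁ hF₁ hε g hg ?_ hu₁ ?_ ?_)
  · intro w hw
    have hw0 : Δ w ≠ 0 := hw.2
    simp only [IsDualPair, map_add, map_smul, smul_eq_mul]
    refine ⟨?_, ?_, ?_, ?_⟩
    all_goals
      field_simp
      simp only [Δ]
      ring
  · simp [hPu, hRu, hΔu]
  · intro v hv
    apply htrans
    have hdiff {Z : Par n → Amb n} (hZ : ContDiffOn ℝ ∞ Z W) : DifferentiableAt ℝ Z u :=
      (hZ.contDiffAt (hW.mem_nhds hu)).differentiableAt (by simp)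
    have hdc {f : Par n → ℝ} (hf : ContDiffOn ℝ ∞ f W₁) : DifferentiableAt ℝ f u :=
      (hf.contDiffAt (hW₁.mem_nhds hu₁)).differentiableAt (by simp)
    rw [(((hdc ha).hasFDerivAt.fun_smul (hdiff hPR.1).hasFDerivAt).fun_add
      ((hdc hb).hasFDerivAt.fun_smul (hdiff hPR.2.1).hasFDerivAt)).fderiv] at hv
    simp [hPu, hRu, hΔu] at hv
    set s := fderiv ℝ (fun w => coordD (g.symm (R w)) / Δ w) u v
    set t := fderiv ℝ (fun y => coordD (g.symm (P y)) / Δ y) u v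
    -- At `u` the new first vector is `P u`, so its derivative differs from `dP(v)` only by a vector
    -- of the line; if it vanishes, transversality of `P` applies.
    have hdP : fderiv ℝ P u v = t • R u - s • P u :=
      eq_sub_of_add_eq (eq_of_sub_eq_zero ((sub_eq_add_neg _ _).trans hv))
    rw [hdP]
    exact (L u).sub_mem ((L u).smul_mem _ hR) ((L u).smul_mem _ hP)

end

end HydroLegendre

end

/-! ### The three assertions together -/

theorem mainTheorem3 (n : ℕ) (U : Set (HydroLegendre.Par n))
    (L : HydroLegendre.Par n → Submodule ℝ (HydroLegendre.Amb n))
    (hL : HydroLegendre.IsRuledHypersurface U L) :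
    -- locally, near each generator, the equivalence holds
    (∀ u ∈ U,
      (∃ W : Set (HydroLegendre.Par n), IsOpen W ∧ u ∈ W ∧ W ⊆ U ∧
        HydroLegendre.CorrespondsToHamiltonian W L) ↔
      (∃ W : Set (HydroLegendre.Par n), IsOpen W ∧ u ∈ W ∧ W ⊆ U ∧
        ∃ β : LinearMap.BilinForm ℝ (HydroLegendre.Amb n),
          HydroLegendre.IsSmoothQuadric β ∧ HydroLegendre.IsLegendre W L β)) ∧
    -- in one direction no shrinking is needed
    (HydroLegendre.CorrespondsToHamiltonian U L →
      ∃ β : LinearMap.BilinForm ℝ (HydroLegendre.Amb n),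
        HydroLegendre.IsSmoothQuadric β ∧ HydroLegendre.IsLegendre U L β) ∧
    -- the conservation laws are independent exactly when no hyperplane contains the hypersurface
    (∀ (W V : Set (HydroLegendre.Par n)) (ε : Fin n → ℝ) (h : HydroLegendre.Par n → ℝ), W ⊆ U →
      HydroLegendre.IsHamiltonianData ε h V →
      HydroLegendre.CorrespondsTo W L (HydroLegendre.hamiltonianSystem ε h) V →
      ((HydroLegendre.hamiltonianSystem ε h).Independent V ↔
        HydroLegendre.IsNondegenerate W L)) := by
  refine ⟨fun u hu => ⟨?_, ?_⟩, HydroLegendre.exists_isLegendre_of_correspondsToHamiltonian,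
    fun W V ε h _ _ hS => HydroLegendre.independent_iff_isNondegenerate hS⟩
  · rintro ⟨W, hW, huW, hWU, hcor⟩
    exact ⟨W, hW, huW, hWU, HydroLegendre.exists_isLegendre_of_correspondsToHamiltonian hcor⟩
  · rintro ⟨W, hW, huW, hWU, β, hβ, hleg⟩
    -- The Legendre neighbourhood need not carry a frame, so it is intersected with one that does;
    -- the sweeping condition is needed only at `u`.
    obtain ⟨W₀, hW₀, huW₀, -, X, Y, hF, hs⟩ := hL.2 u hu
    obtain ⟨W', hW', huW', hsub, hcor⟩ :=
      HydroLegendre.exists_correspondsToHamiltonian_of_isLegendre hβ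
        (hleg.mono Set.inter_subset_left) (hW.inter hW₀)
        ⟨hF.1.mono Set.inter_subset_right, hF.2.1.mono Set.inter_subset_right,
          fun w hw => hF.2.2 w hw.2⟩ ⟨huW, huW₀⟩ hs
    exact ⟨W', hW', huW', hsub.trans (Set.inter_subset_left.trans hWU), hcor⟩
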